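/- Let $S$ be an inverse monoid all of whose $\mathcal R$-classes are finite, and let $\langle A\mid R\rangle$ be an inverse monoid presentation of $S$: $A$ is an alphabet, $\widetilde A^{*}$ is the free monoid on $\widetilde A=A\cup A^{-1}$ with its usual involution $w\mapsto w^{-1}$, $R\subseteq \widetilde A^{*}\times\widetilde A^{*}$ ($A$ and $R$ may be infinite), and $S$ is (isomorphic to) the quotient of $\widetilde A^{*}$ by the congruence generated by $R$ together with all pairs $(ww^{-1}w,\,w)$ and $(uu^{-1}vv^{-1},\,vv^{-1}uu^{-1})$, $u,v,w\in\widetilde A^{*}$. Let $E$ be a set of idempotents of $S$ with $1\notin E$, and for every $e\in E$ let $w_e\in\widetilde A^{*}$ be a Dyck word representing $e$ (a Dyck word is a word which reduces to the empty word by successively erasing factors $aa^{-1}$ with $a\in\widetilde A$, where $(a^{-1})^{-1}=a$; as $e\ne 1$, $w_e$ is nonempty). Let $b\notin A$ be a new letter and let $T$ be the inverse monoid defined by the inverse monoid presentation $$\langle A\cup\{b\}\mid R,\ w_e b=w_e\ (e\in E)\rangle .$$ Then: (i) every $\mathcal R$-class of $T$ is finite; (ii) if $E$ is infinite and no two distinct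 elements of $E$ are $\mathcal J$-comparable in $S$ (that is, $e\notin SfS$ for all distinct $e,f\in E$), then $\mu_T(b)$ is infinite. Here $\mu_T(b)$ is the set of maximal elements of $\{f\in T\mid f^2=f,\ f\le b\}$, where $\le$ is the natural partial order of $T$ ($x\le y$ if and only if $x=gy$ for some idempotent $g\in T$) and $b$ also denotes the element of $T$ represented by the letter $b$. -/

import Mathlib

/-- `M` is an inverse monoid: every element `a` has exactly one inverse, that is, exactly one `b`
with `a b a = a` and `b a b = b`. -/
def IsInverseMonoid (M : Type*) [Monoid M] : Prop :=
  ∀ a : M, ∃! b : M, a * b * a = a ∧ b * a * b = b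

/-- Green's relation `R`: `a` and `b` generate the same principal right ideal. -/
def GreenR {M : Type*} [Monoid M] (a b : M) : Prop :=
  (∃ x, a = b * x) ∧ (∃ y, b = a * y)

/-- Every `R`-class of `M` is finite. -/
def FiniteRClasses (M : Type*) [Monoid M] : Prop :=
  ∀ a : M, {b : M | GreenR b a}.Finite

/-- The preorder `a ≤_J b`: the two-sided ideal generated by `a` lies in the one generated
by `b`. -/
def GreenJLE {M : Type*} [Monoid M] (a b : M) : Prop :=
  ∃ x y, a = x * b * y

/-- `a` and `b` are `J`-comparable (this includes the case of `J`-equivalent elements). -/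
def JComparable {M : Type*} [Monoid M] (a b : M) : Prop :=
  GreenJLE a b ∨ GreenJLE b a

/-- The natural partial order of an inverse monoid: `a ≤ b` iff `a = e b` for an idempotent `e`. -/
def NatLE {M : Type*} [Monoid M] (a b : M) : Prop :=
  ∃ e, IsIdempotentElem e ∧ a = e * b

/-- `λ(s)`: the elements below `s` in the natural partial order. -/
def lowerSet {M : Type*} [Monoid M] (s : M) : Set M :=
  {t | NatLE t s}

/-- `μ(s)`: the maximal elements, for the natural partial order, of the set of idempotents
below `s`. -/
def maxIdempotentsBelow {M : Type*} [Monoid M] (s : M) : Set M :=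
  {e | (e ∈ lowerSet s ∧ IsIdempotentElem e) ∧
    ∀ f, f ∈ lowerSet s → IsIdempotentElem f → NatLE e f → f = e}

/-- Words over the letters of `A` and their formal inverses; `(a, true)` stands for `a` and
`(a, false)` for `a⁻¹`. -/
abbrev InvWord (A : Type*) := FreeMonoid (A × Bool)

/-- The formal inverse of a word: reverse it and invert every letter. -/
def InvWord.inv {A : Type*} (w : InvWord A) : InvWord A :=
  FreeMonoid.ofList (FreeGroup.invRev (FreeMonoid.toList w))

/-- Dyck words: those which reduce to the empty word by successively erasing factors
`a a⁻¹` and `a⁻¹ a`. -/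
def InvWord.IsDyck {A : Type*} (w : InvWord A) : Prop :=
  FreeGroup.Red (FreeMonoid.toList w) []

/-- The generating relations of the inverse monoid given by a set `R` of pairs of words: the
relations which generate the Wagner congruence, together with `R`. -/
inductive InvPresRel {A : Type*} (R : Set (InvWord A × InvWord A)) : InvWord A → InvWord A → Prop
  | regular (w : InvWord A) : InvPresRel R (w * w.inv * w) w
  | comm (u v : InvWord A) : InvPresRel R (u * u.inv * (v * v.inv)) (v * v.inv * (u * u.inv))
  | rel (u v : InvWord A) (h : (u, v) ∈ R) : InvPresRel R u v

/-- The inverse monoid defined by the inverse monoid presentation `⟨A | R⟩`: the quotient of the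
monoid of words by the congruence generated by the Wagner congruence and `R`. -/
abbrev InvPresentedMonoid {A : Type*} (R : Set (InvWord A × InvWord A)) :=
  PresentedMonoid (InvPresRel R)

/-- Words over `A`, seen as words over `A ∪ {b}`. The alphabet `A ∪ {b}` is `Option A`, and `none`
is the new letter `b`. -/
def InvWord.extend {A : Type*} : InvWord A →* InvWord (Option A) :=
  FreeMonoid.map (Prod.map some id)

/-- The new letter `b`, as a word over `A ∪ {b}`. -/
def newLetter (A : Type*) : InvWord (Option A) :=
  FreeMonoid.of (none, true)

/-- The relations `R` together with `w i * b = w i` for all indices `i`, over `A ∪ {b}`. -/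
def extendedRelations {A ι : Type*} (R : Set (InvWord A × InvWord A)) (w : ι → InvWord A) :
    Set (InvWord (Option A) × InvWord (Option A)) :=
  {p | (∃ q ∈ R, p = (q.1.extend, q.2.extend)) ∨
    ∃ i, p = ((w i).extend * newLetter A, (w i).extend)}

/-! The proof uses `T` only through its universal property: a representation of `S` by partial
permutations, together with a partial permutation `β` that fixes every point of the domain of each
`e ∈ E`, extends to `T`. All the work lies in choosing representations. The starting point is the
action of `T` on itself by right translation, `t` being defined at `x` when `x * t * t⁻¹ = x`; its
orbits are the `R`-classes, and these split into lobes, the orbits of `S`.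

Twisting this action by a cocycle into a group `G` gives actions on `T × G`. If `x * t = x`, then
reading `x` and reading `x * t` from `x * x⁻¹` end at the same point, so the loop `t` at `x` has
trivial twist. With `G = ℤ` and a cocycle counting one `b`-loop, this shows that `x * b = x` only if
some `e ∈ E` fixes `x` (`exists_mem_of_mul_eq`). With `G` the group of germs of the stabilizer of
`r`, it shows that elements of `S` translating `r` to the same point agree below an idempotent
fixing `r` (`exists_idem_mul_eq_mul`). Thus a finite part of a lobe looks like part of an `R`-class
of `S`.

For (i), a reading of `t` from `t * t⁻¹` uses finitely many `b`-edges and finitely many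
coincidences, so it lifts to a model made of copies of `S` joined by finitely many `b`-edges
(`exists_reading`). If `y` is `R`-related to `t`, then `y * y⁻¹ = t * t⁻¹`, so `y` can be read from
the same vertex of the model. It ends in a finite union of `R`-classes of copies of `S`, and
evaluation in `T` sends the end point to `y`.

For (ii), sending `b` to `1` retracts `T` onto `S`, so `E` embeds in `T`. An idempotent `f` with `φ
e ≤ f ≤ b` satisfies `f * b = f`, hence lies below some `φ e'` with `e' ∈ E`; incomparability gives
`e' = e` and `f = φ e`. -/

/-! ## Inverse monoids with a chosen inverse operation -/

/-- Inverse monoids, with the inverse as an operation. -/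
class InverseMonoid (M : Type*) [Monoid M] extends Inv M where
  mul_inv_mul (a : M) : a * a⁻¹ * a = a
  inv_inv (a : M) : a⁻¹⁻¹ = a
  inv_mul_rev (a b : M) : (a * b)⁻¹ = b⁻¹ * a⁻¹
  comm (a b : M) : a * a⁻¹ * (b * b⁻¹) = b * b⁻¹ * (a * a⁻¹)

/-- `t` is readable at `x`: the partial right translation by `t` is defined at `x`. -/
def Readable {M : Type*} [Monoid M] [InverseMonoid M] (x t : M) : Prop :=
  x * t * t⁻¹ = x

namespace InverseMonoid

/-- No inverse operation is assumed, because the lemma also serves to construct one on a presented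
monoid; only two pairs of idempotents have to commute. -/
lemma inv_unique {M : Type*} [Monoid M] {a x y : M} (hx : a * x * a = a) (hx' : x * a * x = x)
    (hy : a * y * a = a) (hy' : y * a * y = y)
    (h₁ : x * a * (y * a) = y * a * (x * a)) (h₂ : a * x * (a * y) = a * y * (a * x)) : x = y := by
  have h3 : x = y * a * x := calc
    x = x * (a * y * a) * x := by rw [hy, hx']
    _ = x * a * (y * a) * x := by simp only [mul_assoc]
    _ = y * a * (x * a * x) := by rw [h₁]; simp only [mul_assoc]
    _ = y * a * x := by rw [hx']
  have h4 : y = y * a * x := calc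
    y = y * (a * x * a) * y := by rw [hx, hy']
    _ = y * (a * x * (a * y)) := by simp only [mul_assoc]
    _ = y * a * y * (a * x) := by rw [h₂]; simp only [mul_assoc]
    _ = y * a * x := by rw [hy', mul_assoc]
  rw [h3, ← h4]

variable {M : Type*} [Monoid M] [InverseMonoid M]

lemma mul_inv_mul' (x a : M) : x * a * a⁻¹ * a = x * a := by
  rw [mul_assoc x, mul_assoc, mul_inv_mul]

lemma inv_mul_inv (a : M) : a⁻¹ * a * a⁻¹ = a⁻¹ := by
  simpa only [inv_inv] using mul_inv_mul a⁻¹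

lemma inv_mul_inv' (x a : M) : x * a⁻¹ * a * a⁻¹ = x * a⁻¹ := by
  rw [mul_assoc x, mul_assoc, inv_mul_inv]

lemma comm' (a b : M) : a * a⁻¹ * (b⁻¹ * b) = b⁻¹ * b * (a * a⁻¹) := by
  simpa only [inv_inv] using comm a b⁻¹

lemma comm'' (a b : M) : a⁻¹ * a * (b⁻¹ * b) = b⁻¹ * b * (a⁻¹ * a) := by
  simpa only [inv_inv] using comm a⁻¹ b⁻¹

/-- Commuting `e⁻¹ * e` with `e * e⁻¹` puts a factor `e` at both ends of `e⁻¹`, so `e` is absorbed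
on either side. -/
lemma inv_eq_self_of_idem {e : M} (he : e * e = e) : e⁻¹ = e := by
  have h1 : e⁻¹ = e * (e⁻¹ * e⁻¹) * e := calc
    e⁻¹ = e⁻¹ * (e * e) * e⁻¹ := by rw [he, inv_mul_inv]
    _ = e⁻¹ * e * (e * e⁻¹) := by simp only [mul_assoc]
    _ = e * e⁻¹ * (e⁻¹ * e) := (comm' e e).symm
    _ = _ := by simp only [mul_assoc]
  have h2 : e * e⁻¹ = e⁻¹ := by
    conv_lhs => rw [h1]
    conv_rhs => rw [h1]
    simp only [← mul_assoc, he]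
  have h3 : e⁻¹ * e = e⁻¹ := by
    conv_lhs => rw [h1]
    conv_rhs => rw [h1]
    simp only [mul_assoc, he]
  calc e⁻¹ = e⁻¹ * e := h3.symm
    _ = e * e⁻¹ * e := by rw [h2]
    _ = e := mul_inv_mul e

lemma mul_inv_self_of_idem {e : M} (he : e * e = e) : e * e⁻¹ = e := by
  rw [inv_eq_self_of_idem he, he]

lemma idem_comm {e f : M} (he : e * e = e) (hf : f * f = f) : e * f = f * e := by
  simpa only [mul_inv_self_of_idem he, mul_inv_self_of_idem hf] using comm e f

lemma mul_inv_idem (a : M) : a * a⁻¹ * (a * a⁻¹) = a * a⁻¹ := by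
  rw [← mul_assoc, mul_inv_mul]

lemma inv_mul_idem (a : M) : a⁻¹ * a * (a⁻¹ * a) = a⁻¹ * a := by
  rw [← mul_assoc, inv_mul_inv]

lemma idem_mul {e f : M} (he : e * e = e) (hf : f * f = f) : e * f * (e * f) = e * f := by
  rw [mul_assoc, ← mul_assoc f, idem_comm hf he, mul_assoc, hf, ← mul_assoc, he]

lemma one_inv : (1 : M)⁻¹ = 1 := inv_eq_self_of_idem (one_mul 1)

lemma conj_idem (u : M) {f : M} (hf : f * f = f) :
    u * f * u⁻¹ * (u * f * u⁻¹) = u * f * u⁻¹ := calc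
  _ = u * (f * (u⁻¹ * u)) * f * u⁻¹ := by simp only [mul_assoc]
  _ = u * (u⁻¹ * u * f) * f * u⁻¹ := by rw [idem_comm hf (inv_mul_idem u)]
  _ = u * u⁻¹ * u * (f * f) * u⁻¹ := by simp only [mul_assoc]
  _ = _ := by rw [mul_inv_mul, hf]

lemma eq_inv_of {a x : M} (hx : a * x * a = a) (hx' : x * a * x = x) : x = a⁻¹ := by
  refine inv_unique hx hx' (mul_inv_mul a) (inv_mul_inv a) (idem_comm ?_ ?_) (idem_comm ?_ ?_) <;>
    simp only [← mul_assoc, hx, hx', mul_inv_mul, inv_mul_inv]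

lemma map_inv {N : Type*} [Monoid N] [InverseMonoid N] (f : M →* N) (a : M) :
    f a⁻¹ = (f a)⁻¹ := by
  apply eq_inv_of <;> simp only [← map_mul, mul_inv_mul, inv_mul_inv]

lemma readable_of_idem {x e : M} (he : e * e = e) : Readable x e ↔ x * e = x := by
  rw [Readable, inv_eq_self_of_idem he, mul_assoc, he]

lemma readable_one (x : M) : Readable x 1 := by
  rw [Readable, one_inv, mul_one, mul_one]

lemma readable_mul {x s t : M} : Readable x (s * t) ↔ Readable x s ∧ Readable (x * s) t := by
  unfold Readable
  rw [inv_mul_rev]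
  simp only [← mul_assoc]
  constructor
  · intro h
    refine ⟨?_, ?_⟩
    · conv_lhs => rw [← h]
      rw [inv_mul_inv', h]
    · conv_rhs => rw [← h]
      have := comm' t s
      calc x * s * t * t⁻¹ = x * s * s⁻¹ * s * t * t⁻¹ := by rw [mul_inv_mul']
        _ = x * s * (s⁻¹ * s * (t * t⁻¹)) := by simp only [mul_assoc]
        _ = x * s * t * t⁻¹ * s⁻¹ * s := by rw [← this]; simp only [mul_assoc]
  · rintro ⟨h1, h2⟩
    rw [h2, h1]

lemma Readable.inv {x t : M} (h : Readable x t) : Readable (x * t) t⁻¹ := by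
  unfold Readable at *
  rw [inv_inv, h]

/-- For `q = x⁻¹ * x` the hypothesis says `q ≤ t`. Inversion gives `t⁻¹ * q = q`, then `t * q = q`,
and so `q` lies below `t * t⁻¹`. -/
lemma readable_of_mul_eq {x t : M} (h : x * t = x) : Readable x t := by
  have hq : x⁻¹ * x * t = x⁻¹ * x := by rw [mul_assoc, h]
  have hq1 : t⁻¹ * (x⁻¹ * x) = x⁻¹ * x := by
    have h1 := congrArg (·⁻¹) hq
    simpa only [inv_mul_rev, inv_inv] using h1
  have hq2 : t * (x⁻¹ * x) = x⁻¹ * x := by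
    calc t * (x⁻¹ * x) = t * (t⁻¹ * (x⁻¹ * x * t)) := by rw [hq, hq1]
      _ = t * t⁻¹ * (x⁻¹ * x) * t := by simp only [mul_assoc]
      _ = x⁻¹ * x * t * t⁻¹ * t := by rw [comm']; simp only [mul_assoc]
      _ = x⁻¹ * x := by rw [mul_inv_mul', hq]
  have hq3 : x⁻¹ * x * (t * t⁻¹) = x⁻¹ * x := by
    rw [← comm', mul_assoc, hq1, hq2]
  calc x * t * t⁻¹ = x * x⁻¹ * x * t * t⁻¹ := by rw [mul_inv_mul]
    _ = x * (x⁻¹ * x * (t * t⁻¹)) := by simp only [mul_assoc]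
    _ = x := by rw [hq3, ← mul_assoc, mul_inv_mul]

lemma mul_inv_eq_of_mul_eq {x t : M} (h : x * t = x) : x * t⁻¹ = x := by
  conv_lhs => rw [← h]
  exact readable_of_mul_eq h

lemma readable_self (x : M) : Readable (x * x⁻¹) x := by
  rw [Readable, mul_inv_mul]

lemma Readable.greenR {x t : M} (h : Readable x t) : GreenR (x * t) x :=
  ⟨⟨t, rfl⟩, ⟨t⁻¹, h.symm⟩⟩

lemma greenR_mul_inv {x y : M} (h : GreenR x y) : x * x⁻¹ = y * y⁻¹ := by
  obtain ⟨⟨u, hu⟩, ⟨v, hv⟩⟩ := h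
  have h1 : y * y⁻¹ * (x * x⁻¹) = x * x⁻¹ := by
    rw [← mul_assoc]; congr 1; rw [hu, ← mul_assoc, mul_inv_mul]
  have h2 : x * x⁻¹ * (y * y⁻¹) = y * y⁻¹ := by
    rw [← mul_assoc]; congr 1; rw [hv, ← mul_assoc, mul_inv_mul]
  rw [← h1, comm, h2]

end InverseMonoid

/-- Green's relation `R` is transitive. -/
lemma GreenR.trans {M : Type*} [Monoid M] {a b c : M} (h : GreenR a b) (h' : GreenR b c) :
    GreenR a c := by
  obtain ⟨⟨x, hx⟩, ⟨y, hy⟩⟩ := h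
  obtain ⟨⟨x', hx'⟩, ⟨y', hy'⟩⟩ := h'
  exact ⟨⟨x' * x, by rw [hx, hx', mul_assoc]⟩, ⟨y * y', by rw [hy', hy, mul_assoc]⟩⟩

lemma GreenR.symm {M : Type*} [Monoid M] {a b : M} (h : GreenR a b) : GreenR b a :=
  ⟨h.2, h.1⟩

/-- Transport of the inverse along an isomorphism. -/
@[reducible] def InverseMonoid.ofMulEquiv {M N : Type*} [Monoid M] [InverseMonoid M] [Monoid N]
    (ψ : M ≃* N) : InverseMonoid N where
  inv a := ψ (ψ.symm a)⁻¹
  mul_inv_mul a := ψ.symm.injective (by simp [mul_inv_mul])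
  inv_inv a := ψ.symm.injective (by simp [inv_inv])
  inv_mul_rev a b := ψ.symm.injective (by simp [inv_mul_rev])
  comm a b := ψ.symm.injective (by simp [comm])

/-! ## Partial permutations -/

/-- Partial permutations of `V`, as relations. -/
@[ext] structure PartialPerm (V : Type*) where
  rel : V → V → Prop
  right_unique {x y y' : V} : rel x y → rel x y' → y = y'
  left_unique {x x' y : V} : rel x y → rel x' y → x = x'

namespace PartialPerm

variable {V : Type*}

instance : Monoid (PartialPerm V) where
  mul f g :=
    { rel := fun x z => ∃ y, f.rel x y ∧ g.rel y z
      right_unique := by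
        rintro x z z' ⟨y, h1, h2⟩ ⟨y', h1', h2'⟩
        obtain rfl := f.right_unique h1 h1'
        exact g.right_unique h2 h2'
      left_unique := by
        rintro x z z' ⟨y, h1, h2⟩ ⟨y', h1', h2'⟩
        obtain rfl := g.left_unique h2 h2'
        exact f.left_unique h1 h1' }
  one := ⟨fun x y => x = y, fun h h' => h.symm.trans h', fun h h' => h.trans h'.symm⟩
  mul_assoc f g h := by
    ext x y
    exact ⟨fun ⟨a, ⟨b, h1, h2⟩, h3⟩ => ⟨b, h1, a, h2, h3⟩,
      fun ⟨a, h1, ⟨b, h2, h3⟩⟩ => ⟨b, ⟨a, h1, h2⟩, h3⟩⟩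
  one_mul f := by
    ext x y
    exact ⟨by rintro ⟨_, rfl, h⟩; exact h, fun h => ⟨x, rfl, h⟩⟩
  mul_one f := by
    ext x y
    exact ⟨by rintro ⟨_, h, rfl⟩; exact h, fun h => ⟨y, h, rfl⟩⟩

lemma mul_rel {f g : PartialPerm V} {x z : V} :
    (f * g).rel x z ↔ ∃ y, f.rel x y ∧ g.rel y z := Iff.rfl

lemma one_rel {x y : V} : (1 : PartialPerm V).rel x y ↔ x = y := Iff.rfl

/-- The inverse partial permutation. -/
def symm (f : PartialPerm V) : PartialPerm V where
  rel x y := f.rel y x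
  right_unique := f.left_unique
  left_unique := f.right_unique

lemma mul_symm_rel {f : PartialPerm V} {x y : V} :
    (f * f.symm).rel x y ↔ x = y ∧ ∃ z, f.rel x z :=
  ⟨fun ⟨z, h, h'⟩ => ⟨f.left_unique h h', z, h⟩, by rintro ⟨rfl, z, h⟩; exact ⟨z, h, h⟩⟩

instance : InverseMonoid (PartialPerm V) where
  inv := symm
  mul_inv_mul f := by
    ext x y
    rw [mul_rel]
    simp only [mul_symm_rel]
    exact ⟨by rintro ⟨_, ⟨rfl, _⟩, h⟩; exact h, fun h => ⟨x, ⟨rfl, y, h⟩, h⟩⟩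
  inv_inv f := rfl
  inv_mul_rev f g := by
    ext x y
    exact ⟨fun ⟨z, h, h'⟩ => ⟨z, h', h⟩, fun ⟨z, h, h'⟩ => ⟨z, h', h⟩⟩
  comm f g := by
    ext x y
    rw [mul_rel, mul_rel]
    simp only [mul_symm_rel]
    constructor <;>
    · rintro ⟨_, ⟨rfl, h⟩, rfl, h'⟩
      exact ⟨x, ⟨rfl, h'⟩, rfl, h⟩

end PartialPerm

/-! ## Inverse monoid presentations -/

section Presentation

variable {A : Type*}

lemma InvWord.inv_mul (u v : InvWord A) : (u * v).inv = v.inv * u.inv := by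
  apply FreeMonoid.toList.injective
  simp [InvWord.inv, FreeGroup.invRev]

lemma InvWord.inv_inv (u : InvWord A) : u.inv.inv = u := by
  simp [InvWord.inv]

lemma InvWord.inv_of (a : A) (i : Bool) :
    InvWord.inv (FreeMonoid.of (a, i)) = FreeMonoid.of (a, !i) := rfl

variable (R : Set (InvWord A × InvWord A))

/-- The word inversion, as a homomorphism into the opposite of the presented monoid. -/
def invOpHom : InvPresentedMonoid R →* (InvPresentedMonoid R)ᵐᵒᵖ :=
  PresentedMonoid.lift
    (fun p => MulOpposite.op (PresentedMonoid.mk (InvPresRel R) (FreeMonoid.of (p.1, !p.2)))) (by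
    have key : ∀ w : InvWord A, FreeMonoid.lift (fun p : A × Bool =>
        MulOpposite.op (PresentedMonoid.mk (InvPresRel R) (FreeMonoid.of (p.1, !p.2)))) w =
        MulOpposite.op (PresentedMonoid.mk (InvPresRel R) w.inv) := by
      intro w
      induction w using FreeMonoid.inductionOn with
      | one => rfl
      | of x => rfl
      | mul x y hx hy => rw [map_mul, hx, hy, InvWord.inv_mul, map_mul, MulOpposite.op_mul]
    intro u v h
    rw [key, key]
    congr 1
    -- The set `R` need not be closed under inversion: `u.inv` and `v.inv` are both inverses of the
    -- common class of `u` and `v`, and inverses are unique.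
    have hreg : ∀ w : InvWord A, PresentedMonoid.mk (InvPresRel R) w *
        PresentedMonoid.mk (InvPresRel R) w.inv * PresentedMonoid.mk (InvPresRel R) w =
        PresentedMonoid.mk (InvPresRel R) w := fun w => by
      simpa only [map_mul] using PresentedMonoid.mk_eq_mk_of_rel (InvPresRel.regular (R := R) w)
    have hcomm : ∀ u v : InvWord A, PresentedMonoid.mk (InvPresRel R) u *
        PresentedMonoid.mk (InvPresRel R) u.inv * (PresentedMonoid.mk (InvPresRel R) v *
        PresentedMonoid.mk (InvPresRel R) v.inv) = PresentedMonoid.mk (InvPresRel R) v *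
        PresentedMonoid.mk (InvPresRel R) v.inv * (PresentedMonoid.mk (InvPresRel R) u *
        PresentedMonoid.mk (InvPresRel R) u.inv) := fun u v => by
      simpa only [map_mul] using PresentedMonoid.mk_eq_mk_of_rel (InvPresRel.comm (R := R) u v)
    have hregi := fun w : InvWord A => hreg w.inv
    have hcommi := fun u v : InvWord A => hcomm u.inv v.inv
    simp only [InvWord.inv_inv] at hregi hcommi
    have hv : PresentedMonoid.mk (InvPresRel R) u = PresentedMonoid.mk (InvPresRel R) v :=
      PresentedMonoid.mk_eq_mk_of_rel h
    have h1 := hreg v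
    have h3 := hcomm u v
    have h4 := hcommi u v
    have h2 := hregi v
    rw [← hv] at h1 h2 h3 h4
    exact InverseMonoid.inv_unique (hreg u) (hregi u) h1 h2 h4 h3)

lemma invOpHom_mk (w : InvWord A) : invOpHom R (PresentedMonoid.mk (InvPresRel R) w) =
    MulOpposite.op (PresentedMonoid.mk (InvPresRel R) w.inv) := by
  induction w using FreeMonoid.inductionOn with
  | one => rfl
  | of x => rfl
  | mul x y hx hy => rw [map_mul, map_mul, hx, hy, InvWord.inv_mul, map_mul, MulOpposite.op_mul]

instance : InverseMonoid (InvPresentedMonoid R) where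
  inv x := (invOpHom R x).unop
  mul_inv_mul x := by
    induction x using PresentedMonoid.inductionOn with | _ w
    simpa only [map_mul, invOpHom_mk, MulOpposite.unop_op] using
      PresentedMonoid.mk_eq_mk_of_rel (InvPresRel.regular (R := R) w)
  inv_inv x := by
    induction x using PresentedMonoid.inductionOn with | _ w
    simp only [invOpHom_mk, MulOpposite.unop_op, InvWord.inv_inv]
  inv_mul_rev x y := by simp only [map_mul, MulOpposite.unop_mul]
  comm x y := by
    induction x using PresentedMonoid.inductionOn with | _ u
    induction y using PresentedMonoid.inductionOn with | _ v
    simpa only [map_mul, invOpHom_mk, MulOpposite.unop_op] using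
      PresentedMonoid.mk_eq_mk_of_rel (InvPresRel.comm (R := R) u v)

variable {R}

lemma mk_inv (w : InvWord A) : (PresentedMonoid.mk (InvPresRel R) w)⁻¹ =
    PresentedMonoid.mk (InvPresRel R) w.inv :=
  congrArg MulOpposite.unop (invOpHom_mk R w)

/-- The value of a letter or of its formal inverse. -/
def letterValue {M : Type*} [Inv M] (f : A → M) (p : A × Bool) : M :=
  if p.2 then f p.1 else (f p.1)⁻¹

lemma lift_inv {M : Type*} [Monoid M] [InverseMonoid M] (f : A → M) (w : InvWord A) :
    FreeMonoid.lift (letterValue f) w.inv = (FreeMonoid.lift (letterValue f) w)⁻¹ := by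
  induction w using FreeMonoid.inductionOn with
  | one => exact InverseMonoid.one_inv.symm
  | of x =>
    obtain ⟨a, i⟩ := x
    rw [InvWord.inv_of, FreeMonoid.lift_eval_of, FreeMonoid.lift_eval_of]
    cases i <;> simp [letterValue, InverseMonoid.inv_inv]
  | mul x y hx hy => rw [InvWord.inv_mul, map_mul, map_mul, hx, hy, InverseMonoid.inv_mul_rev]

/-- The universal property of an inverse monoid presentation. -/
def invLift {M : Type*} [Monoid M] [InverseMonoid M] (f : A → M)
    (h : ∀ p ∈ R, FreeMonoid.lift (letterValue f) p.1 = FreeMonoid.lift (letterValue f) p.2) :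
    InvPresentedMonoid R →* M :=
  PresentedMonoid.lift (letterValue f) (by
    intro u v huv
    cases huv with
    | regular => simp only [map_mul, lift_inv, InverseMonoid.mul_inv_mul]
    | comm => simpa only [map_mul, lift_inv] using InverseMonoid.comm _ _
    | rel _ _ h' => exact h _ h')

lemma invLift_mk {M : Type*} [Monoid M] [InverseMonoid M] (f : A → M)
    (h : ∀ p ∈ R, FreeMonoid.lift (letterValue f) p.1 = FreeMonoid.lift (letterValue f) p.2)
    (w : InvWord A) :
    invLift f h (PresentedMonoid.mk (InvPresRel R) w) = FreeMonoid.lift (letterValue f) w := rfl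

end Presentation

/-! ### The extension and its universal property -/

open InverseMonoid

universe u v

/-- `T` is generated, as an inverse monoid, by the image of `S` and the element `b`, subject to
`φ e * b = φ e` for `e ∈ E`, and is universal with this property. -/
structure IsUniversalExtension {S : Type v} {T : Type u} [Monoid S] [InverseMonoid S] [Monoid T]
    [InverseMonoid T] (E : Set S) (φ : S →* T) (b : T) : Prop where
  idem : ∀ e ∈ E, e * e = e
  absorb : ∀ e ∈ E, φ e * b = φ e
  induction : ∀ P : T → Prop, (∀ s, P (φ s)) → P b → (∀ x y, P x → P y → P (x * y)) →
    (∀ x, P x → P x⁻¹) → ∀ t, P t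
  lift : ∀ (M : Type (max u v)) [Monoid M] [InverseMonoid M] (θ : S →* M) (β : M),
    (∀ e ∈ E, θ e * β = θ e) → ∃ Θ : T →* M, (∀ s, Θ (φ s) = θ s) ∧ Θ b = β

section Adjoin

variable {A : Type u} {S : Type v} {R : Set (InvWord A × InvWord A)}
  {E : Set S} (w : E → InvWord A)

lemma lift_extend {M : Type*} [Monoid M] [InverseMonoid M] (f : Option A → M) (u : InvWord A) :
    FreeMonoid.lift (letterValue f) u.extend =
      FreeMonoid.lift (letterValue fun a => f (some a)) u := by
  induction u using FreeMonoid.inductionOn with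
  | one => rfl
  | of x => rfl
  | mul x y hx hy => simp only [map_mul, hx, hy]

lemma lift_letterValue_mk {B : Type*} {Q : Set (InvWord B × InvWord B)} (u : InvWord B) :
    FreeMonoid.lift (letterValue fun a =>
      PresentedMonoid.mk (InvPresRel Q) (FreeMonoid.of (a, true))) u =
      PresentedMonoid.mk (InvPresRel Q) u := by
  induction u using FreeMonoid.inductionOn with
  | one => rfl
  | of x =>
    obtain ⟨a, i⟩ := x
    rw [FreeMonoid.lift_eval_of]
    cases i with
    | true => rfl
    | false => exact (mk_inv _).trans rfl
  | mul x y hx hy => simp only [map_mul, hx, hy]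

lemma lift_letterValue_some_mk {B : Type*} {Q : Set (InvWord (Option B) × InvWord (Option B))}
    (u : InvWord B) :
    FreeMonoid.lift (letterValue fun a =>
      PresentedMonoid.mk (InvPresRel Q) (FreeMonoid.of (some a, true))) u =
      PresentedMonoid.mk (InvPresRel Q) u.extend := by
  rw [← lift_letterValue_mk u.extend, lift_extend]

/-- The canonical homomorphism between the presented monoids. -/
def presentedBaseHom : InvPresentedMonoid R →* InvPresentedMonoid (extendedRelations R w) :=
  invLift (fun a => PresentedMonoid.mk _ (FreeMonoid.of (some a, true))) (by
    intro p hp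
    rw [lift_letterValue_some_mk, lift_letterValue_some_mk]
    exact PresentedMonoid.mk_eq_mk_of_rel (InvPresRel.rel _ _ (Or.inl ⟨p, hp, rfl⟩)))

lemma presentedBaseHom_mk (u : InvWord A) :
    presentedBaseHom w (PresentedMonoid.mk (InvPresRel R) u) =
      PresentedMonoid.mk _ u.extend :=
  lift_letterValue_some_mk u

variable [Monoid S] (ψ : InvPresentedMonoid R ≃* S)

/-- The canonical homomorphism from `S` to the extended monoid. -/
def baseHom : S →* InvPresentedMonoid (extendedRelations R w) :=
  (presentedBaseHom w).comp ψ.symm.toMonoidHom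

lemma baseHom_mk (u : InvWord A) : baseHom w ψ (ψ (PresentedMonoid.mk (InvPresRel R) u)) =
    PresentedMonoid.mk _ u.extend := by
  simp [baseHom, presentedBaseHom_mk]

variable {w} in
-- The universe of `M` is arbitrary here, so that the case `M = S`, `β = 1` also yields the
-- retraction onto `S`.
lemma exists_lift (hw : ∀ e : E, ψ (PresentedMonoid.mk (InvPresRel R) (w e)) = e)
    {M : Type*} [Monoid M] [InverseMonoid M] (θ : S →* M) (β : M) (h : ∀ e ∈ E, θ e * β = θ e) :
    ∃ Θ : InvPresentedMonoid (extendedRelations R w) →* M,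
      (∀ s, Θ (baseHom w ψ s) = θ s) ∧ Θ (PresentedMonoid.mk _ (newLetter A)) = β := by
  let g : A → M := fun a => θ (ψ (PresentedMonoid.mk _ (FreeMonoid.of (a, true))))
  have hg : ∀ u : InvWord A, FreeMonoid.lift (letterValue g) u =
      θ (ψ (PresentedMonoid.mk (InvPresRel R) u)) := by
    intro u
    induction u using FreeMonoid.inductionOn with
    | one => simp
    | of x =>
      obtain ⟨a, i⟩ := x
      rw [FreeMonoid.lift_eval_of]
      cases i with
      | true => rfl
      | false =>
        have := InverseMonoid.map_inv (θ.comp ψ.toMonoidHom)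
          (PresentedMonoid.mk (InvPresRel R) (FreeMonoid.of (a, true)))
        rw [mk_inv] at this
        exact this.symm
    | mul x y hx hy => simp only [map_mul, hx, hy]
  let f : Option A → M := fun o => o.elim β g
  have hf : ∀ u : InvWord A, FreeMonoid.lift (letterValue f) u.extend =
      θ (ψ (PresentedMonoid.mk (InvPresRel R) u)) := fun u => (lift_extend f u).trans (hg u)
  have hb : FreeMonoid.lift (letterValue f) (newLetter A) = β := rfl
  refine ⟨invLift f ?_, ?_, hb⟩
  · rintro p (⟨q, hq, rfl⟩ | ⟨e, rfl⟩)
    · simp only [hf]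
      rw [PresentedMonoid.mk_eq_mk_of_rel (InvPresRel.rel _ _ hq)]
    · simp only [map_mul, hf, hb, hw]
      exact h e e.2
  · intro s
    obtain ⟨x, rfl⟩ := ψ.surjective s
    induction x using PresentedMonoid.inductionOn with | _ u
    rw [baseHom_mk, invLift_mk, hf]

theorem isUniversalExtension [InverseMonoid S] (hE : ∀ e ∈ E, e * e = e)
    (hw : ∀ e : E, ψ (PresentedMonoid.mk (InvPresRel R) (w e)) = e) :
    IsUniversalExtension E (baseHom w ψ)
      (PresentedMonoid.mk (InvPresRel (extendedRelations R w)) (newLetter A)) where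
  idem := hE
  absorb e he := by
    have h : ψ (PresentedMonoid.mk (InvPresRel R) (w ⟨e, he⟩)) = e := hw ⟨e, he⟩
    rw [← h, baseHom_mk, ← map_mul]
    exact PresentedMonoid.mk_eq_mk_of_rel (InvPresRel.rel _ _ (Or.inr ⟨⟨e, he⟩, rfl⟩))
  induction P hφ hb hmul hinv t := by
    induction t using PresentedMonoid.inductionOn with | _ u
    induction u using FreeMonoid.inductionOn with
    | one => simpa using hφ 1
    | of x =>
      have key : ∀ o : Option A, P (PresentedMonoid.mk _ (FreeMonoid.of (o, true))) := by
        rintro (_ | a)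
        · exact hb
        · have := hφ (ψ (PresentedMonoid.mk _ (FreeMonoid.of (a, true))))
          rw [baseHom_mk] at this
          exact this
      obtain ⟨o, i⟩ := x
      cases i with
      | true => exact key o
      | false =>
        have := hinv _ (key o)
        rw [mk_inv] at this
        exact this
    | mul x y hx hy => rw [map_mul]; exact hmul _ _ hx hy
  lift _ _ _ θ β h := exists_lift ψ hw θ β h

end Adjoin

lemma InverseMonoid.map_idem {S T : Type*} [Monoid S] [Monoid T] {φ : S →* T} {e : S} (he : e * e = e) :
    φ e * φ e = φ e := by
  rw [← map_mul, he]

/-! ### Cocycle twists of right translation -/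

namespace IsUniversalExtension

variable {S : Type v} {T : Type u} [Monoid S] [InverseMonoid S] [Monoid T] [InverseMonoid T]
  {E : Set S} {φ : S →* T} {b : T}

lemma mul_eq_of_idem (H : IsUniversalExtension E φ b) {x : T} {e : S} (he : e ∈ E)
    (hx : x * φ e = x) : x * b = x := by
  conv_lhs => rw [← hx]
  rw [mul_assoc, H.absorb e he, hx]

/-- Monoid homomorphisms to partial permutations which extend a partial right translation action
by a cocycle with values in a group. -/
theorem exists_cocycle_extension (H : IsUniversalExtension E φ b) {G : Type v} [Group G]
    (ρ : T → S → G) (σ : T → G)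
    (hρ : ∀ x s t, Readable x (φ s) → Readable (x * φ s) (φ t) →
      ρ x (s * t) = ρ x s * ρ (x * φ s) t)
    (hσ : ∀ x, ∀ e ∈ E, x * φ e = x → σ x = 1) :
    ∃ Θ : T →* PartialPerm (T × G),
      (∀ t x, Readable x t → ∃ c, ∀ g, (Θ t).rel (x, g) (x * t, g * c)) ∧
      (∀ s x g, Readable x (φ s) → (Θ (φ s)).rel (x, g) (x * φ s, g * ρ x s)) ∧
      (∀ x g, Readable x b → (Θ b).rel (x, g) (x * b, g * σ x)) := by
  -- The cocycle identity at `e * e = e` reads `ρ x e = ρ x e * ρ x e`.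
  have hidem : ∀ x e, e * e = e → x * φ e = x → ρ x e = 1 := by
    intro x e he hx
    have hr := (readable_of_idem (map_idem (φ := φ) he)).2 hx
    have := hρ x e e hr (by rwa [hx])
    rwa [he, hx, left_eq_mul] at this
  let θ : S →* PartialPerm (T × G) :=
    { toFun := fun s =>
        { rel := fun p q => Readable p.1 (φ s) ∧ q = (p.1 * φ s, p.2 * ρ p.1 s)
          right_unique := fun h h' => h.2.trans h'.2.symm
          left_unique := by
            rintro ⟨x, g⟩ ⟨y, k⟩ z ⟨h1, rfl⟩ ⟨h2, h3⟩
            rw [Prod.mk.injEq] at h3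
            dsimp only at h1 h2 h3
            have hxy : x = y := by rw [← h1, h3.1, h2]
            subst hxy
            rw [mul_right_cancel h3.2] }
      map_one' := by
        ext ⟨x, g⟩ ⟨y, k⟩
        have h1 := hidem x 1 (one_mul 1) (by rw [map_one, mul_one])
        simp only [map_one, mul_one, h1, PartialPerm.one_rel, readable_one, true_and]
        exact eq_comm
      map_mul' := by
        intro s t
        ext ⟨x, g⟩ z
        rw [PartialPerm.mul_rel]
        simp only [map_mul, readable_mul]
        constructor
        · rintro ⟨⟨h1, h2⟩, rfl⟩
          refine ⟨_, ⟨h1, rfl⟩, h2, ?_⟩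
          simp only [hρ x s t h1 h2, mul_assoc]
        · rintro ⟨_, ⟨h1, rfl⟩, h2, rfl⟩
          refine ⟨⟨h1, h2⟩, ?_⟩
          simp only [hρ x s t h1 h2, mul_assoc] }
  let β : PartialPerm (T × G) :=
    { rel := fun p q => Readable p.1 b ∧ q = (p.1 * b, p.2 * σ p.1)
      right_unique := fun h h' => h.2.trans h'.2.symm
      left_unique := by
        rintro ⟨x, g⟩ ⟨y, k⟩ z ⟨h1, rfl⟩ ⟨h2, h3⟩
        rw [Prod.mk.injEq] at h3
        dsimp only at h1 h2 h3
        have hxy : x = y := by rw [← h1, h3.1, h2]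
        subst hxy
        rw [mul_right_cancel h3.2] }
  have hβ : ∀ e ∈ E, θ e * β = θ e := by
    intro e he
    ext ⟨x, g⟩ z
    rw [PartialPerm.mul_rel]
    have key : Readable x (φ e) → x * φ e = x ∧ x * b = x ∧ Readable x b ∧ ρ x e = 1 ∧
        σ x = 1 := by
      intro h
      have h1 := (readable_of_idem (map_idem (H.idem e he))).1 h
      have h2 := H.mul_eq_of_idem he h1
      exact ⟨h1, h2, readable_of_mul_eq h2, hidem x e (H.idem e he) h1, hσ x e he h1⟩
    constructor
    · rintro ⟨_, ⟨h1, rfl⟩, h2, rfl⟩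
      obtain ⟨h3, h4, h5, h6, h7⟩ := key h1
      refine ⟨h1, ?_⟩
      simp only [h3, h4, h6, h7, mul_one]
    · rintro ⟨h1, rfl⟩
      obtain ⟨h3, h4, h5, h6, h7⟩ := key h1
      refine ⟨_, ⟨h1, rfl⟩, ?_, ?_⟩
      · simpa only [h3] using h5
      · simp only [h3, h4, h6, h7, mul_one]
  obtain ⟨Θ, hΘ, hΘb⟩ := H.lift _ θ β hβ
  refine ⟨Θ, ?_, ?_, ?_⟩
  · refine H.induction _ ?_ ?_ ?_ ?_
    · intro s x h
      rw [hΘ]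
      exact ⟨ρ x s, fun g => ⟨h, rfl⟩⟩
    · intro x h
      rw [hΘb]
      exact ⟨σ x, fun g => ⟨h, rfl⟩⟩
    · intro s t hs ht x h
      obtain ⟨h1, h2⟩ := readable_mul.1 h
      obtain ⟨c, hc⟩ := hs x h1
      obtain ⟨d, hd⟩ := ht _ h2
      refine ⟨c * d, fun g => ?_⟩
      rw [map_mul, ← mul_assoc, ← mul_assoc]
      exact ⟨_, hc g, hd _⟩
    · intro t ht x h
      have h1 := h.inv
      rw [InverseMonoid.inv_inv] at h1
      obtain ⟨c, hc⟩ := ht _ h1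
      refine ⟨c⁻¹, fun g => ?_⟩
      have h2 := hc (g * c⁻¹)
      have h3 : x * t⁻¹ * t = x := by
        simpa only [Readable, InverseMonoid.inv_inv] using h
      rw [h3, inv_mul_cancel_right] at h2
      rw [InverseMonoid.map_inv]
      exact h2
  · intro s x g h
    rw [hΘ]
    exact ⟨h, rfl⟩
  · intro x g h
    rw [hΘb]
    exact ⟨h, rfl⟩

/-- Along a cocycle extension, stabilizers of points act trivially on the group coordinate. -/
lemma rel_self_of_mul_eq {G : Type v} [Group G] {Θ : T →* PartialPerm (T × G)}
    (hΘ : ∀ t x, Readable x t → ∃ c, ∀ g, (Θ t).rel (x, g) (x * t, g * c)) {x t : T}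
    (hx : x * t = x) {c : G} (hc : ∀ g, (Θ t).rel (x, g) (x, g * c)) : c = 1 := by
  -- From `(x * x⁻¹, 1)`, reading `x` ends at `(x, d)` and reading `x * t` at `(x, d * c)`; both are
  -- the same element of `T`.
  obtain ⟨d, hd⟩ := hΘ x (x * x⁻¹) (readable_self x)
  have h1 := hd 1
  rw [mul_inv_mul] at h1
  have h2 : (Θ (x * t)).rel (x * x⁻¹, 1) (x, 1 * d * c) := by
    rw [map_mul]
    exact ⟨_, h1, hc _⟩
  rw [hx] at h2
  have h3 := (Prod.mk.inj ((Θ x).right_unique h1 h2)).2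
  exact left_eq_mul.1 h3

/-- A `b`-loop in the extension is caused by an element of `E`. -/
theorem exists_mem_of_mul_eq (H : IsUniversalExtension E φ b) {x : T} (hx : x * b = x) :
    ∃ e ∈ E, x * φ e = x := by
  classical
  by_contra! hcon
  -- The cocycle is a generator of ℤ on the edge `b` at `x` and trivial elsewhere; it is admissible
  -- as long as no `e ∈ E` fixes `x`.
  let z : ULift.{v} (Multiplicative ℤ) := ⟨Multiplicative.ofAdd 1⟩
  obtain ⟨Θ, h1, -, h3⟩ := H.exists_cocycle_extension (G := ULift.{v} (Multiplicative ℤ))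
    (fun _ _ => 1) (fun y => if y = x then z else 1) (fun _ _ _ _ _ => (one_mul 1).symm)
    (fun y e he hy => if_neg (by rintro rfl; exact hcon e he hy))
  have h4 : z = 1 := rel_self_of_mul_eq h1 hx fun g => by
    simpa only [hx, if_true] using h3 x g (readable_of_mul_eq hx)
  have h5 : (1 : ℤ) = 0 := congrArg (fun y => Multiplicative.toAdd (ULift.down y)) h4
  exact one_ne_zero h5

/-- The idempotents of `E` are maximal below `b`, if they are pairwise incomparable. -/
theorem map_mem_maxIdempotentsBelow (H : IsUniversalExtension E φ b) {r : T →* S}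
    (hr : ∀ s, r (φ s) = s) (hE : ∀ e ∈ E, ∀ f ∈ E, e * f = e → e = f) {e : S} (he : e ∈ E) :
    φ e ∈ maxIdempotentsBelow b := by
  have hee := map_idem (φ := φ) (H.idem e he)
  refine ⟨⟨⟨φ e, hee, (H.absorb e he).symm⟩, hee⟩, ?_⟩
  rintro f ⟨g, hg, hgf⟩ hf ⟨k, hk, hkf⟩
  -- Here `f = g * b` gives `g * f = f`, and the idempotents `f` and `g` commute.
  have h1 : f * b = f := by
    have h2 : g * f = f := by rw [hgf, ← mul_assoc, hg.eq]
    conv_rhs => rw [← hf.eq, hgf]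
    rw [← mul_assoc, ← hgf, idem_comm hf.eq hg.eq, h2]
  obtain ⟨e', he', hfe⟩ := H.exists_mem_of_mul_eq h1
  have h2 : φ e * φ e' = φ e := by
    conv_lhs => rw [hkf, mul_assoc, hfe, ← hkf]
  have h3 : e = e' := hE e he e' he' (by simpa only [map_mul, hr] using congrArg r h2)
  subst h3
  have h4 : φ e * f = φ e := by
    conv_lhs => rw [hkf, mul_assoc, hf.eq, ← hkf]
  rw [← hfe, idem_comm hf.eq hee, h4]

end IsUniversalExtension

/-! ### Lobes: the orbits of `S` inside an `R`-class -/

section Lobes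

variable {S : Type v} {T : Type u} [Monoid S] [Monoid T] [InverseMonoid T] (φ : S →* T) (r : T)

/-- The lobe of `r`: the elements which are right translates of `r` by elements of `S`, inside
the `R`-class of `r`. -/
def SameLobe (r y : T) : Prop := ∃ s : S, Readable r (φ s) ∧ r * φ s = y

open Classical in
/-- A choice of an element of `S` which translates `r` to `y`. -/
noncomputable def connector (y : T) : S :=
  if h : SameLobe φ r y then h.choose else 1

variable {φ r}

lemma SameLobe.readable {y : T} (h : SameLobe φ r y) : Readable r (φ (connector φ r y)) := by
  rw [connector, dif_pos h]
  exact h.choose_spec.1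

lemma SameLobe.mul_connector {y : T} (h : SameLobe φ r y) : r * φ (connector φ r y) = y := by
  rw [connector, dif_pos h]
  exact h.choose_spec.2

lemma sameLobe_refl (r : T) : SameLobe φ r r :=
  ⟨1, by rw [map_one]; exact readable_one r, by simp⟩

lemma sameLobe_mul {x : T} {s : S} (h : Readable x (φ s)) : SameLobe φ x (x * φ s) := ⟨s, h, rfl⟩

lemma SameLobe.trans {x y z : T} (h : SameLobe φ x y) (h' : SameLobe φ y z) :
    SameLobe φ x z := by
  obtain ⟨s, h1, rfl⟩ := h
  obtain ⟨t, h2, rfl⟩ := h'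
  refine ⟨s * t, ?_, ?_⟩
  · rw [map_mul, readable_mul]
    exact ⟨h1, h2⟩
  · rw [map_mul, mul_assoc]

end Lobes

/-! ### Germs of stabilizers, and when two elements of `S` act alike -/

section Germs

variable {S : Type v} {T : Type u} [Monoid S] [InverseMonoid S] [Monoid T] [InverseMonoid T]

/-- The elements of `S` which stabilize `r`. -/
def stab (φ : S →* T) (r : T) : Submonoid S where
  carrier := {s | r * φ s = r}
  one_mem' := by simp
  mul_mem' := by
    intro s t hs ht
    change r * φ (s * t) = r
    rw [map_mul, ← mul_assoc, show r * φ s = r from hs, show r * φ t = r from ht]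

variable (φ : S →* T) (r : T)

lemma mem_stab_inv {φ : S →* T} {r : T} {s : S} (hs : r * φ s = r) : r * φ s⁻¹ = r := by
  rw [InverseMonoid.map_inv]
  exact mul_inv_eq_of_mul_eq hs

/-- Elements of the stabilizer of `r` have the same germ if they agree below an idempotent of the
stabilizer. -/
def germCon : Con (stab φ r) where
  r s t := ∃ e : S, e * e = e ∧ r * φ e = r ∧ e * s = e * t
  iseqv :=
    { refl := fun s => ⟨1, one_mul 1, by simp, rfl⟩
      symm := fun ⟨e, h1, h2, h3⟩ => ⟨e, h1, h2, h3.symm⟩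
      trans := by
        rintro s t u ⟨e, h1, h2, h3⟩ ⟨f, h4, h5, h6⟩
        refine ⟨e * f, idem_mul h1 h4, by rw [map_mul, ← mul_assoc, h2, h5], ?_⟩
        rw [mul_assoc e f u, ← h6, idem_comm h1 h4, mul_assoc, h3, ← mul_assoc, ← idem_comm h1 h4,
          mul_assoc] }
  mul' := by
    rintro s t s' t' ⟨e, h1, h2, h3⟩ ⟨f, h4, h5, h6⟩
    have key : ∀ a c : S, (e * a) * f * (e * a)⁻¹ * (a * c) = e * a * (f * c) := by
      intro a c
      have h7 : (e * a)⁻¹ * a = (e * a)⁻¹ * (e * a) := by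
        rw [inv_mul_rev, inv_eq_self_of_idem h1, mul_assoc, mul_assoc, ← mul_assoc e e, h1]
      calc (e * a) * f * (e * a)⁻¹ * (a * c)
          = e * a * (f * ((e * a)⁻¹ * a)) * c := by simp only [mul_assoc]
        _ = e * a * ((e * a)⁻¹ * (e * a) * f) * c := by
          rw [h7, idem_comm h4 (inv_mul_idem _)]
        _ = e * a * (e * a)⁻¹ * (e * a) * f * c := by simp only [mul_assoc]
        _ = _ := by rw [mul_inv_mul, mul_assoc]
    have hes : r * φ (e * s) = r := by rw [map_mul, ← mul_assoc, h2, s.2]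
    -- To act on the left of `s`, the idempotent `f` is conjugated by `e * s`; the result still
    -- fixes `r`, because `e * s` does.
    refine ⟨(e * s) * f * (e * s)⁻¹, conj_idem _ h4, ?_, ?_⟩
    · rw [map_mul, map_mul, ← mul_assoc, ← mul_assoc, hes, h5, mem_stab_inv hes]
    · rw [Submonoid.coe_mul, Submonoid.coe_mul, key, h6, h3, key]

open Classical in
/-- The germ of an element of the stabilizer of `r`; the value is `1` for all other elements. -/
noncomputable def germ (s : S) : (germCon φ r).Quotientˣ :=
  if h : r * φ s = r then
    { val := ((⟨s, h⟩ : stab φ r) : (germCon φ r).Quotient)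
      inv := ((⟨s⁻¹, mem_stab_inv h⟩ : stab φ r) : (germCon φ r).Quotient)
      val_inv := by
        rw [← Con.coe_mul, ← Con.coe_one, Con.eq]
        refine ⟨s * s⁻¹, mul_inv_idem s, ?_, ?_⟩
        · rw [map_mul, ← mul_assoc, h, mem_stab_inv h]
        · rw [Submonoid.coe_mul, Submonoid.coe_one, mul_one, mul_inv_idem]
      inv_val := by
        rw [← Con.coe_mul, ← Con.coe_one, Con.eq]
        refine ⟨s⁻¹ * s, inv_mul_idem s, ?_, ?_⟩
        · rw [map_mul, ← mul_assoc, mem_stab_inv h, h]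
        · rw [Submonoid.coe_mul, Submonoid.coe_one, mul_one, inv_mul_idem] }
  else 1

variable {φ r}

lemma germ_eq_iff {s t : S} (hs : r * φ s = r) (ht : r * φ t = r) :
    germ φ r s = germ φ r t ↔ ∃ e : S, e * e = e ∧ r * φ e = r ∧ e * s = e * t := by
  rw [germ, germ, dif_pos hs, dif_pos ht, Units.ext_iff]
  exact Con.eq _

lemma germ_mul {s t : S} (hs : r * φ s = r) (ht : r * φ t = r) :
    germ φ r (s * t) = germ φ r s * germ φ r t := by
  have hst : r * φ (s * t) = r := by rw [map_mul, ← mul_assoc, hs, ht]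
  rw [germ, germ, germ, dif_pos hs, dif_pos ht, dif_pos hst, Units.ext_iff]
  rfl

lemma germ_one : germ φ r 1 = 1 := by
  have h : r * φ 1 = r := by simp
  have := germ_mul h h
  rwa [mul_one, left_eq_mul] at this

lemma SameLobe.symm {x y : T} (h : SameLobe φ x y) : SameLobe φ y x := by
  obtain ⟨s, h1, rfl⟩ := h
  refine ⟨s⁻¹, ?_, ?_⟩
  · rw [InverseMonoid.map_inv]
    exact h1.inv
  · rw [InverseMonoid.map_inv]
    exact h1

variable (φ r)

/-- The germ at `r` of the loop through `y` and `y * φ s`. -/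
noncomputable def loopGerm (y : T) (s : S) : (germCon φ r).Quotientˣ :=
  germ φ r (connector φ r y * s * (connector φ r (y * φ s))⁻¹)

variable {φ r}

lemma mul_loop {y : T} {s : S} (hy : SameLobe φ r y) (hs : Readable y (φ s)) :
    r * φ (connector φ r y * s * (connector φ r (y * φ s))⁻¹) = r := by
  have hys := hy.trans (sameLobe_mul hs)
  have h1 := hys.readable
  rw [Readable, hys.mul_connector] at h1
  rw [map_mul, map_mul, InverseMonoid.map_inv, ← mul_assoc, ← mul_assoc, hy.mul_connector, h1]

/-- The product of the two loops differs from the loop of `s * t` only by a factor `q⁻¹ * q` in the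
middle. Conjugated by `p * s`, it moves to the front as an idempotent fixing `r`, which germs do not
see. -/
lemma loopGerm_mul {y : T} {s t : S} (hy : SameLobe φ r y) (hs : Readable y (φ s))
    (ht : Readable (y * φ s) (φ t)) :
    loopGerm φ r y (s * t) = loopGerm φ r y s * loopGerm φ r (y * φ s) t := by
  have hys := hy.trans (sameLobe_mul hs)
  have h1 := mul_loop hy hs
  have h2 := mul_loop hys ht
  have h3 : y * φ (s * t) = y * φ s * φ t := by rw [map_mul, mul_assoc]
  have h4 : r * φ (connector φ r y * (s * t) * (connector φ r (y * φ (s * t)))⁻¹) = r :=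
    mul_loop hy (by rw [map_mul, readable_mul]; exact ⟨hs, ht⟩)
  rw [loopGerm, loopGerm, loopGerm, ← germ_mul h1 h2, germ_eq_iff h4, h3]
  · set p := connector φ r y
    set q := connector φ r (y * φ s)
    set q' := connector φ r (y * φ s * φ t)
    refine ⟨p * s * (q⁻¹ * q) * (p * s)⁻¹, conj_idem _ (inv_mul_idem q), ?_, ?_⟩
    · have h5 : Readable r (φ (p * s)) := by
        rw [map_mul, readable_mul, hy.mul_connector]
        exact ⟨hy.readable, hs⟩
      have h6 : r * φ (p * s * q⁻¹ * q) = r * φ (p * s) := by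
        rw [map_mul, ← mul_assoc, h1, hys.mul_connector, map_mul, ← mul_assoc, hy.mul_connector]
      rw [← mul_assoc, map_mul, ← mul_assoc r, h6, InverseMonoid.map_inv, h5]
    · have h7 := idem_comm (inv_mul_idem q) (inv_mul_idem (p * s))
      calc p * s * (q⁻¹ * q) * (p * s)⁻¹ * (p * (s * t) * q'⁻¹)
          = p * s * (q⁻¹ * q * ((p * s)⁻¹ * (p * s))) * t * q'⁻¹ := by simp only [mul_assoc]
        _ = p * s * (q⁻¹ * q * ((p * s)⁻¹ * (p * s)) * (q⁻¹ * q)) * t * q'⁻¹ := by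
          rw [h7, mul_assoc ((p * s)⁻¹ * (p * s)), inv_mul_idem]
        _ = _ := by simp only [mul_assoc]
  · rw [map_mul, ← mul_assoc, h1, h2]

end Germs

namespace IsUniversalExtension

variable {S : Type v} {T : Type u} [Monoid S] [InverseMonoid S] [Monoid T] [InverseMonoid T]
  {E : Set S} {φ : S →* T} {b : T}

/-- An element of `S` which stabilizes `r` lies above an idempotent which stabilizes `r`. -/
theorem exists_idem_mul_eq (H : IsUniversalExtension E φ b) {r : T} {s : S} (hs : r * φ s = r) :
    ∃ e : S, e * e = e ∧ r * φ e = r ∧ e * s = e := by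
  classical
  obtain ⟨Θ, h1, h2, -⟩ := H.exists_cocycle_extension (G := (germCon φ r).Quotientˣ)
    (fun y s => if SameLobe φ r y then loopGerm φ r y s else 1) (fun _ => 1)
    (by
      intro x s t hxs hxt
      by_cases hx : SameLobe φ r x
      · rw [if_pos hx, if_pos hx, if_pos (hx.trans (sameLobe_mul hxs)), loopGerm_mul hx hxs hxt]
      · rw [if_neg hx, if_neg hx, if_neg, one_mul]
        exact fun h => hx (h.trans (sameLobe_mul hxs).symm))
    (fun _ _ _ _ => rfl)
  have h3 : loopGerm φ r r s = 1 := by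
    refine rel_self_of_mul_eq h1 hs fun g => ?_
    simpa only [hs, if_pos (sameLobe_refl (φ := φ) r)] using h2 s r g (readable_of_mul_eq hs)
  have hp := (sameLobe_refl (φ := φ) r).mul_connector
  have hps : r * φ (connector φ r r * s) = r := by rw [map_mul, ← mul_assoc, hp, hs]
  -- The chosen connector from `r` to itself need not be `1`; comparison with the loop of `1`
  -- cancels it.
  have h4 : loopGerm φ r r 1 = 1 := by
    have := loopGerm_mul (s := 1) (t := 1) (sameLobe_refl (φ := φ) r)
      (by rw [map_one]; exact readable_one r) (by rw [map_one]; exact readable_one _)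
    rwa [mul_one, map_one, mul_one, left_eq_mul] at this
  rw [loopGerm, hs, germ_mul hps (mem_stab_inv hp), germ_mul hp hs] at h3
  rw [loopGerm, map_one, mul_one, mul_one, germ_mul hp (mem_stab_inv hp)] at h4
  have h5 : germ φ r s = germ φ r 1 := by
    rw [germ_one]
    have h6 := h3.trans h4.symm
    rw [mul_assoc] at h6
    exact right_eq_mul.1 (mul_left_cancel h6).symm
  obtain ⟨e, h6, h7, h8⟩ := (germ_eq_iff hs (by simp)).1 h5
  exact ⟨e, h6, h7, by rw [h8, mul_one]⟩

/-- Elements of `S` which translate `r` to the same element agree below an idempotent which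
stabilizes `r`. -/
theorem exists_idem_mul_eq_mul (H : IsUniversalExtension E φ b) {r : T} {s t : S}
    (ht : Readable r (φ t)) (hst : r * φ s = r * φ t) :
    ∃ e : S, e * e = e ∧ r * φ e = r ∧ e * s = e * t := by
  have h1 : r * φ (s * t⁻¹) = r := by
    rw [map_mul, ← mul_assoc, hst, InverseMonoid.map_inv, ht]
  obtain ⟨e, h2, h3, h4⟩ := H.exists_idem_mul_eq h1
  -- With `e * s * t⁻¹ = e` and its inverse form, `e * s` and `e * t` are restrictions of each
  -- other, hence equal.
  have h5 : e * (t * s⁻¹) = e := by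
    have := mul_inv_eq_of_mul_eq h4
    rwa [inv_mul_rev, InverseMonoid.inv_inv] at this
  have h6 : e * s * (t⁻¹ * t) = e * t := by
    conv_rhs => rw [← h4]
    simp only [mul_assoc]
  have h7 : e * t * (s⁻¹ * s) = e * s := by
    conv_rhs => rw [← h5]
    simp only [mul_assoc]
  refine ⟨e, h2, h3, ?_⟩
  calc e * s = e * s * (t⁻¹ * t) * (s⁻¹ * s) := by rw [h6, h7]
    _ = e * (s * s⁻¹ * s) * (t⁻¹ * t) := by
      rw [mul_assoc (e * s), comm'']; simp only [mul_assoc]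
    _ = e * t := by rw [mul_inv_mul, h6]

end IsUniversalExtension

/-! ### Models from copies of `S`, and finiteness of `R`-classes -/

section LocalUnits

variable {S : Type v} {T : Type u} [Monoid S] [Monoid T]

/-- A choice of an idempotent of `S` stabilizing `r`, for every `r`. -/
def IsLocalUnit (φ : S →* T) (h : T → S) : Prop :=
  ∀ r, h r * h r = h r ∧ r * φ (h r) = r

variable {φ : S →* T} {h : T → S}

lemma isLocalUnit_one : IsLocalUnit φ (fun _ => 1) :=
  fun r => ⟨one_mul 1, by simp⟩

open Classical in
lemma isLocalUnit_single {r : T} {e : S} (he : e * e = e) (hr : r * φ e = r) :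
    IsLocalUnit φ (fun x => if x = r then e else 1) := by
  intro x
  dsimp only
  split_ifs with hx
  · subst hx
    exact ⟨he, hr⟩
  · exact isLocalUnit_one x

lemma IsLocalUnit.mul [InverseMonoid S] {k : T → S} (hh : IsLocalUnit φ h) (hk : IsLocalUnit φ k) :
    IsLocalUnit φ (fun r => h r * k r) := fun r =>
  ⟨idem_mul (hh r).1 (hk r).1, by rw [map_mul, ← mul_assoc, (hh r).2, (hk r).2]⟩

end LocalUnits

section Places

variable {S : Type v} {T : Type u} [Monoid S] [InverseMonoid S] [Monoid T] [InverseMonoid T]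

/-- The partition of `T` into lobes. -/
def lobeSetoid (φ : S →* T) : Setoid T where
  r := SameLobe φ
  iseqv := ⟨sameLobe_refl, SameLobe.symm, SameLobe.trans⟩

/-- The base point of the lobe of `y`. -/
noncomputable def lobeBase (φ : S →* T) (y : T) : T :=
  (Quotient.mk (lobeSetoid φ) y).out

/-- The vertex over `y` of the disjoint union of the right regular representations of `S`, where
the base point `r` of a lobe is represented by the idempotent `h r`. -/
noncomputable def place (φ : S →* T) (h : T → S) (y : T) : T × S :=
  (lobeBase φ y, h (lobeBase φ y) * connector φ (lobeBase φ y) y)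

/-- The union of the `R`-classes of the vertices over `D`. -/
def placeClasses (φ : S →* T) (h : T → S) (D : Set T) : Set (T × S) :=
  {p | ∃ z ∈ D, p.1 = (place φ h z).1 ∧ GreenR p.2 (place φ h z).2}

variable {φ : S →* T} {h : T → S}

lemma lobeBase_sameLobe (y : T) : SameLobe φ (lobeBase φ y) y :=
  Quotient.exact (s := lobeSetoid φ) (Quotient.out_eq _)

lemma lobeBase_eq {x y : T} (hxy : SameLobe φ x y) : lobeBase φ x = lobeBase φ y :=
  congrArg Quotient.out (Quotient.sound (s := lobeSetoid φ) hxy)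

lemma IsLocalUnit.place_eval (hh : IsLocalUnit φ h) (y : T) :
    (place φ h y).1 * φ (place φ h y).2 = y := by
  rw [place, map_mul, ← mul_assoc, (hh _).2, (lobeBase_sameLobe y).mul_connector]

lemma IsLocalUnit.place_injective (hh : IsLocalUnit φ h) {x y : T}
    (hxy : place φ h x = place φ h y) : x = y := by
  rw [← hh.place_eval x, hxy, hh.place_eval]

lemma finite_placeClasses (hS : FiniteRClasses S) {D : Set T} (hD : D.Finite) :
    (placeClasses φ h D).Finite := by
  refine (hD.biUnion fun z _ => ((Set.finite_singleton (place φ h z).1).prod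
    (hS (place φ h z).2))).subset ?_
  rintro ⟨r, s⟩ ⟨z, hz, h1, h2⟩
  simp only [Set.mem_iUnion]
  exact ⟨z, hz, h1, h2⟩

lemma place_mem_placeClasses {D : Set T} {z : T} (hz : z ∈ D) :
    place φ h z ∈ placeClasses φ h D :=
  ⟨z, hz, rfl, ⟨1, (mul_one _).symm⟩, ⟨1, (mul_one _).symm⟩⟩

end Places

section LobeModels

variable {S : Type v} {T : Type u} [Monoid S] [InverseMonoid S] [Monoid T] [InverseMonoid T]
  {E : Set S} {φ : S →* T} {b : T} {h : T → S}

/-- An action of `T` on `T × S` by partial permutations which contains the right regular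
representation of `S` in the second coordinate, and the `b`-edges within `D`. -/
structure IsLobeModel (E : Set S) (φ : S →* T) (b : T) (D : Set T) (h : T → S)
    (Θ : T →* PartialPerm (T × S)) : Prop where
  translate : ∀ r u s, Readable u s → (Θ (φ s)).rel (r, u) (r, u * s)
  loop : ∀ r u, ∀ e ∈ E, u * e = u → (Θ b).rel (r, u) (r, u)
  edge : ∀ y ∈ D, y * b ∈ D → Readable y b → y * b ≠ y →
    (Θ b).rel (place φ h y) (place φ h (y * b))
  eval : ∀ t p q, (Θ t).rel p q →
    (p.1 * φ p.2 * t = q.1 * φ q.2 ∧ Readable (p.1 * φ p.2) t) ∧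
      (p ∈ placeClasses φ h D ↔ q ∈ placeClasses φ h D)

namespace IsUniversalExtension

/-- An `e ∈ E` fixing either end of a `b`-edge puts a `b`-loop there, and injectivity of translation
by `b` makes the edge itself that loop. -/
lemma mul_ne_of_mul_ne (H : IsUniversalExtension E φ b) {y : T} (hy : Readable y b)
    (hyb : y * b ≠ y) {e : S} (he : e ∈ E) : y * φ e ≠ y ∧ y * b * φ e ≠ y * b := by
  refine ⟨fun h1 => hyb (H.mul_eq_of_idem he h1), fun h1 => hyb ?_⟩
  have h2 := mul_inv_eq_of_mul_eq (H.mul_eq_of_idem he h1)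
  rw [← h2, hy]

/-- The required loops at points fixed by `E` never meet the chosen edges, since evaluation in `T`
would turn such an edge into a loop. Evaluation also separates places, so the edges form a partial
injection. -/
theorem exists_isLobeModel (H : IsUniversalExtension E φ b) (D : Set T) (hh : IsLocalUnit φ h) :
    ∃ Θ, IsLobeModel E φ b D h Θ := by
  let θ : S →* PartialPerm (T × S) :=
    { toFun := fun s =>
        { rel := fun p q => Readable p.2 s ∧ q = (p.1, p.2 * s)
          right_unique := fun h h' => h.2.trans h'.2.symm
          left_unique := by
            rintro ⟨x, g⟩ ⟨y, k⟩ z ⟨h1, rfl⟩ ⟨h2, h3⟩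
            rw [Prod.mk.injEq] at h3
            dsimp only at h1 h2 h3
            rw [Prod.mk.injEq, h3.1, ← h1, h3.2, h2]
            exact ⟨rfl, rfl⟩ }
      map_one' := by
        ext ⟨x, g⟩ ⟨y, k⟩
        simp only [mul_one, PartialPerm.one_rel, readable_one, true_and]
        exact eq_comm
      map_mul' := by
        intro s t
        ext ⟨x, g⟩ z
        rw [PartialPerm.mul_rel]
        simp only [readable_mul]
        constructor
        · rintro ⟨⟨h1, h2⟩, rfl⟩
          exact ⟨_, ⟨h1, rfl⟩, h2, by simp only [mul_assoc]⟩
        · rintro ⟨_, ⟨h1, rfl⟩, h2, rfl⟩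
          exact ⟨⟨h1, h2⟩, by simp only [mul_assoc]⟩ }
  have hsrc : ∀ y, Readable y b → y * b ≠ y → ∀ e ∈ E, (place φ h y).2 * e ≠ (place φ h y).2 := by
    intro y h1 h2 e he h3
    refine (H.mul_ne_of_mul_ne h1 h2 he).1 ?_
    conv_lhs => rw [← hh.place_eval y]
    rw [mul_assoc, ← map_mul, h3, hh.place_eval]
  have htgt : ∀ y, Readable y b → y * b ≠ y → ∀ e ∈ E,
      (place φ h (y * b)).2 * e ≠ (place φ h (y * b)).2 := by
    intro y h1 h2 e he h3
    refine (H.mul_ne_of_mul_ne h1 h2 he).2 ?_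
    conv_lhs => rw [← hh.place_eval (y * b)]
    rw [mul_assoc, ← map_mul, h3, hh.place_eval]
  let β : PartialPerm (T × S) :=
    { rel := fun p q => ((∃ e ∈ E, p.2 * e = p.2) ∧ q = p) ∨
        ∃ y ∈ D, y * b ∈ D ∧ Readable y b ∧ y * b ≠ y ∧ p = place φ h y ∧ q = place φ h (y * b)
      right_unique := by
        rintro p q q' (⟨⟨e, he, h1⟩, rfl⟩ | ⟨y, -, -, h3, h4, rfl, rfl⟩)
          (⟨⟨e', he', h1'⟩, rfl⟩ | ⟨y', -, -, h3', h4', h5, rfl⟩)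
        · rfl
        · subst h5
          exact absurd h1 (hsrc y' h3' h4' e he)
        · exact absurd h1' (hsrc y h3 h4 e' he')
        · rw [hh.place_injective h5]
      left_unique := by
        rintro p p' q (⟨⟨e, he, h1⟩, rfl⟩ | ⟨y, -, -, h3, h4, rfl, rfl⟩)
          (⟨⟨e', he', h1'⟩, h5⟩ | ⟨y', -, -, h3', h4', rfl, h5⟩)
        · exact h5
        · subst h5
          exact absurd h1 (htgt y' h3' h4' e he)
        · subst h5
          exact absurd h1' (htgt y h3 h4 e' he')
        · have h6 := hh.place_injective h5
          rw [← h3, h6, h3'] }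
  have hβ : ∀ e ∈ E, θ e * β = θ e := by
    intro e he
    ext ⟨x, g⟩ q
    rw [PartialPerm.mul_rel]
    constructor
    · rintro ⟨_, ⟨h1, rfl⟩, h2⟩
      have h3 := (readable_of_idem (H.idem e he)).1 h1
      dsimp only at h2 h3
      rw [h3] at h2
      obtain rfl := β.right_unique h2 (Or.inl ⟨⟨e, he, h3⟩, rfl⟩)
      exact ⟨h1, by rw [h3]⟩
    · rintro ⟨h1, rfl⟩
      have h3 := (readable_of_idem (H.idem e he)).1 h1
      refine ⟨_, ⟨h1, rfl⟩, ?_⟩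
      dsimp only at h3 ⊢
      rw [h3]
      exact Or.inl ⟨⟨e, he, h3⟩, rfl⟩
  obtain ⟨Θ, hΘ, hΘb⟩ := H.lift _ θ β hβ
  refine ⟨Θ, ?_, ?_, ?_, ?_⟩
  · intro r u s h1
    rw [hΘ]
    exact ⟨h1, rfl⟩
  · intro r u e he h1
    rw [hΘb]
    exact Or.inl ⟨⟨e, he, h1⟩, rfl⟩
  · intro y h1 h2 h3 h4
    rw [hΘb]
    exact Or.inr ⟨y, h1, h2, h3, h4, rfl, rfl⟩
  · refine H.induction _ ?_ ?_ ?_ ?_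
    · rintro s ⟨r, u⟩ q hq
      rw [hΘ] at hq
      obtain ⟨h1, rfl⟩ := hq
      dsimp only at h1 ⊢
      refine ⟨⟨by rw [map_mul, mul_assoc], ?_⟩, ?_⟩
      · unfold Readable at h1 ⊢
        rw [← InverseMonoid.map_inv, mul_assoc, mul_assoc, ← map_mul, ← map_mul, ← mul_assoc, h1]
      · exact exists_congr fun z => and_congr_right fun _ => and_congr_right fun _ =>
          ⟨fun h2 => h1.greenR.trans h2, fun h2 => h1.greenR.symm.trans h2⟩
    · intro p q hq
      rw [hΘb] at hq
      obtain ⟨⟨e, he, h1⟩, rfl⟩ | ⟨y, h1, h2, h3, h4, rfl, rfl⟩ := hq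
      · have h2 : q.1 * φ q.2 * φ e = q.1 * φ q.2 := by rw [mul_assoc, ← map_mul, h1]
        have h3 := H.mul_eq_of_idem he h2
        exact ⟨⟨h3, readable_of_mul_eq h3⟩, Iff.rfl⟩
      · rw [hh.place_eval, hh.place_eval]
        exact ⟨⟨rfl, h3⟩, iff_of_true (place_mem_placeClasses h1) (place_mem_placeClasses h2)⟩
    · rintro s t hs ht p q hq
      rw [map_mul] at hq
      obtain ⟨m, h1, h2⟩ := hq
      obtain ⟨⟨h3, h4⟩, h5⟩ := hs p m h1
      obtain ⟨⟨h6, h7⟩, h8⟩ := ht m q h2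
      exact ⟨⟨by rw [← mul_assoc, h3, h6], readable_mul.2 ⟨h4, by rwa [h3]⟩⟩, h5.trans h8⟩
    · intro t ht p q hq
      rw [InverseMonoid.map_inv] at hq
      obtain ⟨⟨h1, h2⟩, h3⟩ := ht q p hq
      rw [← h1]
      exact ⟨⟨h2, h2.inv⟩, h3.symm⟩

/-- Every readable element can be read in all sufficiently large models. -/
theorem exists_reading (H : IsUniversalExtension E φ b) (t : T) : ∀ x, Readable x t →
    ∃ D₀ : Set T, D₀.Finite ∧ ∃ k, IsLocalUnit φ k ∧ ∀ D h Θ, D₀ ⊆ D → (∀ r, h r * k r = h r) →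
      IsLobeModel E φ b D h Θ → (Θ t).rel (place φ h x) (place φ h (x * t)) := by
  classical
  refine H.induction (fun t => ∀ x, Readable x t →
    ∃ D₀ : Set T, D₀.Finite ∧ ∃ k, IsLocalUnit φ k ∧ ∀ D h Θ, D₀ ⊆ D → (∀ r, h r * k r = h r) →
      IsLobeModel E φ b D h Θ → (Θ t).rel (place φ h x) (place φ h (x * t))) ?_ ?_ ?_ ?_ t
  · intro s x hx
    have hbase : lobeBase φ (x * φ s) = lobeBase φ x := (lobeBase_eq (sameLobe_mul hx)).symm
    have hp := lobeBase_sameLobe (φ := φ) x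
    have hq := lobeBase_sameLobe (φ := φ) (x * φ s)
    rw [hbase] at hq
    -- Below `e`, translating the place of `x` by `s` gives exactly the place of `x * φ s`.
    obtain ⟨e, he, h1, h2⟩ := H.exists_idem_mul_eq_mul
      (s := connector φ (lobeBase φ x) x * s) hq.readable
      (by rw [map_mul, ← mul_assoc, hp.mul_connector, hq.mul_connector])
    -- Below `f`, the element `s` is readable at the place of `x` already in `S`.
    obtain ⟨f, hf, h3, h4⟩ := H.exists_idem_mul_eq_mul
      (s := connector φ (lobeBase φ x) x * (s * s⁻¹)) hp.readable
      (by rw [map_mul, ← mul_assoc, hp.mul_connector, map_mul, ← mul_assoc,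
        InverseMonoid.map_inv, hx])
    refine ⟨∅, Set.finite_empty, _, (isLocalUnit_single he h1).mul (isLocalUnit_single hf h3), ?_⟩
    intro D h Θ _ hk hΘ
    have h5 := hk (lobeBase φ x)
    rw [if_pos rfl, if_pos rfl] at h5
    have h6 : h (lobeBase φ x) * e = h (lobeBase φ x) := by
      conv_lhs => rw [← h5]
      rw [mul_assoc, mul_assoc, idem_comm hf he, ← mul_assoc e, he, h5]
    have h7 : h (lobeBase φ x) * f = h (lobeBase φ x) := by
      conv_lhs => rw [← h5]
      rw [mul_assoc, mul_assoc, hf, h5]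
    have h8 := hΘ.translate (lobeBase φ x) (h (lobeBase φ x) * connector φ (lobeBase φ x) x) s
      (by
        rw [Readable]
        conv_rhs => rw [← h7, mul_assoc, ← h4, ← mul_assoc, h7]
        simp only [mul_assoc])
    rw [place, place, hbase]
    convert h8 using 2
    conv_lhs => rw [← h6, mul_assoc, ← h2, ← mul_assoc, h6]
    rw [mul_assoc]
  · intro x hx
    by_cases hxb : x * b = x
    · obtain ⟨e, he, h1⟩ := H.exists_mem_of_mul_eq hxb
      have hp := lobeBase_sameLobe (φ := φ) x
      -- Below `f`, the place of `x` is fixed by `e`, so the model has a loop there.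
      obtain ⟨f, hf, h3, h4⟩ := H.exists_idem_mul_eq_mul
        (s := connector φ (lobeBase φ x) x * e) hp.readable
        (by rw [map_mul, ← mul_assoc, hp.mul_connector, h1])
      refine ⟨∅, Set.finite_empty, _, isLocalUnit_single hf h3, ?_⟩
      intro D h Θ _ hk hΘ
      have h7 := hk (lobeBase φ x)
      rw [if_pos rfl] at h7
      rw [hxb, place]
      refine hΘ.loop _ _ e he ?_
      conv_rhs => rw [← h7, mul_assoc, ← h4, ← mul_assoc, h7]
      rw [mul_assoc]
    · refine ⟨{x, x * b}, by simp, _, isLocalUnit_one, ?_⟩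
      intro D h Θ hD _ hΘ
      exact hΘ.edge x (hD (by simp)) (hD (by simp)) hx hxb
  · intro s t hs ht x hx
    obtain ⟨h1, h2⟩ := readable_mul.1 hx
    obtain ⟨D₁, hD₁, k₁, hk₁, h3⟩ := hs x h1
    obtain ⟨D₂, hD₂, k₂, hk₂, h4⟩ := ht _ h2
    refine ⟨D₁ ∪ D₂, hD₁.union hD₂, _, hk₁.mul hk₂, ?_⟩
    intro D h Θ hD hk hΘ
    rw [map_mul, ← mul_assoc]
    refine ⟨_, h3 D h Θ (Set.subset_union_left.trans hD) ?_ hΘ,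
      h4 D h Θ (Set.subset_union_right.trans hD) ?_ hΘ⟩
    · intro r
      conv_lhs => rw [← hk r]
      rw [mul_assoc, mul_assoc, idem_comm (hk₂ r).1 (hk₁ r).1, ← mul_assoc (k₁ r), (hk₁ r).1, hk r]
    · intro r
      conv_lhs => rw [← hk r]
      rw [mul_assoc, mul_assoc, (hk₂ r).1, hk r]
  · intro t ht x hx
    have h1 := hx.inv
    rw [InverseMonoid.inv_inv] at h1
    obtain ⟨D₀, hD₀, k, hk, h2⟩ := ht _ h1
    refine ⟨D₀, hD₀, k, hk, ?_⟩
    intro D h Θ hD hhk hΘ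
    have h3 := h2 D h Θ hD hhk hΘ
    have h4 : x * t⁻¹ * t = x := by
      simpa only [Readable, InverseMonoid.inv_inv] using hx
    rw [h4] at h3
    rw [InverseMonoid.map_inv]
    exact h3

/-- The `R`-classes of the extension are finite if those of `S` are. -/
theorem finiteRClasses (H : IsUniversalExtension E φ b) (hS : FiniteRClasses S) :
    FiniteRClasses T := by
  intro t
  obtain ⟨D₀, hD₀, h, hh, h1⟩ := H.exists_reading t (t * t⁻¹) (readable_self t)
  -- The starting point joins `D`, so that its place lies in the finite invariant set.
  obtain ⟨Θ, hΘ⟩ := H.exists_isLobeModel (insert (t * t⁻¹) D₀) hh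
  have h2 := h1 _ h Θ (Set.subset_insert _ _) (fun r => (hh r).1) hΘ
  refine ((finite_placeClasses (φ := φ) (h := h) hS (hD₀.insert (t * t⁻¹))).image
    fun p => p.1 * φ p.2).subset ?_
  intro y hy
  have h3 : (Θ (t * t⁻¹)).rel (place φ h (t * t⁻¹)) (place φ h (t * t⁻¹)) := by
    rw [map_mul, InverseMonoid.map_inv]
    exact ⟨_, h2, h2⟩
  -- Since `t * t⁻¹ = y * y⁻¹` is defined at the starting place, so is its first factor `y`.
  rw [← greenR_mul_inv hy, map_mul] at h3
  obtain ⟨q, h4, -⟩ := h3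
  rw [greenR_mul_inv hy] at h4
  obtain ⟨⟨h5, -⟩, h6⟩ := hΘ.eval y _ q h4
  refine ⟨q, h6.1 (place_mem_placeClasses (Set.mem_insert _ _)), ?_⟩
  dsimp only
  rw [← h5, hh.place_eval, ← greenR_mul_inv hy, mul_inv_mul]

end IsUniversalExtension

end LobeModels

theorem mainTheorem1 {A : Type*} {S : Type*} [Monoid S] (hS : IsInverseMonoid S)
    (hfin : FiniteRClasses S)
    (R : Set (InvWord A × InvWord A)) (ψ : InvPresentedMonoid R ≃* S)
    (E : Set S) (hE : ∀ e ∈ E, IsIdempotentElem e ∧ e ≠ 1)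
    (w : E → InvWord A) (hDyck : ∀ e : E, (w e).IsDyck)
    (hw : ∀ e : E, ψ (PresentedMonoid.mk (InvPresRel R) (w e)) = e) :
    FiniteRClasses (InvPresentedMonoid (extendedRelations R w)) ∧
    (E.Infinite → E.Pairwise (fun e f => ¬ JComparable e f) →
      (maxIdempotentsBelow
        (PresentedMonoid.mk (InvPresRel (extendedRelations R w)) (newLetter A))).Infinite) := by
  let _ : InverseMonoid S := InverseMonoid.ofMulEquiv ψ
  have H := isUniversalExtension w ψ (fun e he => (hE e he).1) hw
  refine ⟨H.finiteRClasses hfin, fun hinf hpair => ?_⟩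
  obtain ⟨r, hr, -⟩ := exists_lift ψ hw (MonoidHom.id S) 1 (fun e _ => mul_one _)
  refine (hinf.image (f := baseHom w ψ) ?_).mono ?_
  · exact (Function.LeftInverse.injective (g := r) hr).injOn
  · rintro _ ⟨e, he, rfl⟩
    refine H.map_mem_maxIdempotentsBelow hr ?_ he
    intro e he f hf hef
    by_contra hne
    exact hpair he hf hne (Or.inl ⟨e, 1, by rw [mul_one, hef]⟩)
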